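/- For $r \ge 2$, a family $\mathcal{F}$ of subsets of $[n] = \{1,\dots,n\}$ is called $r$-bisection closed if for every $2 \le t \le r$ and any $t$ distinct sets $A_1,\dots,A_t \in \mathcal{F}$ we have $|A_1\cap\dots\cap A_t| \in \{\tfrac12|A_1|,\dots,\tfrac12|A_t|\}$. For a permutation $\sigma$ of $[n]$ put $\sigma(\mathcal{F}) = \{\sigma(A) : A\in\mathcal{F}\}$. For $n \ge 2$ let $\mathcal{F}_{\max}$ be the family over $[n]$ that consists of all sets $\{1,j\}$ with $2 \le j \le n$ and all sets $\{1,2,2k+1,2k+2\}$ with $k \ge 1$ and $2k+2 \le n$. Theorem. Let $n \ge 2$ and $r \ge 3$, and let $\mathcal{F}$ be an $r$-bisection closed family of nonempty subsets of $[n]$. (Bound) If $n \le 3$, assume that $\mathcal{F}$ contains no one-element set. Then $|\mathcal{F}| \le \lfloor \tfrac{3n}{2}\rfloor - 2$. (Tightness) The family $\mathcal{F}_{\max}$ is $r$-bisection closed, all its members have at least two elements, and $|\mathcal{F}_{\max}| = \lfloor \tfrac{3n}{2}\rfloor - 2$. (Uniqueness) If $n \le 5$, assume that $\mathcal{F}$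 contains no one-element set. If $|\mathcal{F}| = \lfloor \tfrac{3n}{2}\rfloor - 2$, then there is a permutation $\sigma$ of $[n]$ such that $\mathcal{F}_{\max} = \sigma(\mathcal{F})$. (Robustness) There is an absolute constant $C > 0$, independent of $n$, $r$, $\mathcal{F}$ and $\epsilon$, such that the following holds: if $0 < \epsilon < 0.1$ and $|\mathcal{F}| \ge (\tfrac32 - \epsilon) n$, then for some permutation $\sigma$ of $[n]$ we have $|\sigma(\mathcal{F}) \setminus \mathcal{F}_{\max}| < C\epsilon n$. -/

import Mathlib

/-- A family `F` of subsets of an `n`-element ground set is `r`-closed `L`-intersecting: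
for `2 ≤ t ≤ r` and any `t` distinct members `A₁, …, A_t` of `F`, the size of
`A₁ ∩ ⋯ ∩ A_t` is `θ |A_i|` for some `i` and some `θ ∈ L`. -/
def IsClosedIntersecting {n : ℕ} (r : ℕ) (L : Set ℚ) (F : Finset (Finset (Fin n))) : Prop :=
  ∀ t : ℕ, 2 ≤ t → t ≤ r → ∀ A : Fin t → Finset (Fin n), Function.Injective A →
    (∀ i, A i ∈ F) →
      ∃ i, ∃ θ ∈ L, ((Finset.univ.inf A).card : ℚ) = θ * ((A i).card : ℚ)

/-- `r`-bisection closed families: the case `L = {1/2}`. -/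
def IsBisectionClosed {n : ℕ} (r : ℕ) (F : Finset (Finset (Fin n))) : Prop :=
  IsClosedIntersecting r {1 / 2} F

/-- The family of all `2`-sets `{0, b}` with `1 ≤ b < n` and all `4`-sets `{0, 1, 2k, 2k + 1}`
with `1 ≤ k` and `2k + 1 < n`, over the ground set `{0, …, n - 1}`. With the ground set written
as `{1, …, n}` these are `12, 13, …, 1n, 1234, 1256, …`. -/
noncomputable def maxFamily (n : ℕ) : Finset (Finset (Fin n)) :=
  open Classical in
  Finset.univ.filter fun A =>
    (∃ a b : Fin n, a.val = 0 ∧ 1 ≤ b.val ∧ A = {a, b}) ∨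
    (∃ (k : ℕ) (a b c d : Fin n), 1 ≤ k ∧ a.val = 0 ∧ b.val = 1 ∧ c.val = 2 * k ∧
      d.val = 2 * k + 1 ∧ A = {a, b, c, d})

/-- The image `σ(F) = {σ(A) : A ∈ F}` of a family under a permutation of the ground set. -/
def permFamily {n : ℕ} (σ : Equiv.Perm (Fin n)) (F : Finset (Finset (Fin n))) :
    Finset (Finset (Fin n)) :=
  F.image fun A => A.image σ

/-! Only intersections of two and three members are needed for the bounds. If `A` and `C` meet in
half of `A` and |A| ≤ |C|, the triple condition forces `A ∩ C` into every member at least as large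
as `A`. Hence each even `A` has a half P(A), its petal, disjoint from every other member of size at
least |A| that meets `A` in half of `A` (`exists_petal`). So petals of members of equal size are
disjoint, and members whose petals share a point have sizes within a factor of two.

Put weight 2/|A| on each point of P(A), so that each member has total weight 1. If the smallest
member whose petal contains a point has size 2a, the point carries at most 1/a + ... + 1/(2a): this
is 3/2 for a = 1, 13/12 for a = 2 and at most 19/20 beyond (`exists_counts`). An even family thus
has at most 3n/2 members, and coming close requires many 2-sets. Two 2-sets give a point common to
all members, which petals can avoid; a 4-set also has two points outside all petals of 4-sets. These
losses give the exact bound. An odd member adds one set but removes at least three points from all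
other petals.

In a near-extremal family almost all members are 2-sets through a common point x or 4-sets that meet
pairwise in a fixed pair {x, y}; relabelling sends these into `maxFamily`. -/

/-! ### Intersections of two and three members; petals. -/

theorem IsBisectionClosed.pair {n r : ℕ} {F : Finset (Finset (Fin n))}
    (h : IsBisectionClosed r F) (hr : 2 ≤ r) {A B : Finset (Fin n)} (hA : A ∈ F) (hB : B ∈ F)
    (hAB : A ≠ B) : 2 * (A ∩ B).card = A.card ∨ 2 * (A ∩ B).card = B.card := by
  obtain ⟨i, θ, hθ, hi⟩ := h 2 le_rfl hr ![A, B]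
    (by intro i j hij; fin_cases i <;> fin_cases j <;> simp_all [hAB.symm])
    (by intro i; fin_cases i <;> simp [hA, hB])
  have hinf : Finset.univ.inf ![A, B] = A ∩ B := by
    simp [Fin.univ_succ, Finset.inf_insert]
  rw [hinf, Set.mem_singleton_iff.1 hθ] at hi
  fin_cases i
  · left
    have : (2 * (A ∩ B).card : ℚ) = A.card := by rw [hi]; simp
    exact_mod_cast this
  · right
    have : (2 * (A ∩ B).card : ℚ) = B.card := by rw [hi]; simp
    exact_mod_cast this

theorem IsBisectionClosed.triple {n r : ℕ} {F : Finset (Finset (Fin n))}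
    (h : IsBisectionClosed r F) (hr : 3 ≤ r) {A B C : Finset (Fin n)} (hA : A ∈ F) (hB : B ∈ F)
    (hC : C ∈ F) (hAB : A ≠ B) (hAC : A ≠ C) (hBC : B ≠ C) :
    2 * (A ∩ B ∩ C).card = A.card ∨ 2 * (A ∩ B ∩ C).card = B.card ∨
      2 * (A ∩ B ∩ C).card = C.card := by
  obtain ⟨i, θ, hθ, hi⟩ := h 3 (by norm_num) hr ![A, B, C]
    (by
      intro i j hij
      fin_cases i <;> fin_cases j <;> simp_all [hAB.symm, hAC.symm, hBC.symm])
    (by intro i; fin_cases i <;> simp [hA, hB, hC])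
  have hinf : Finset.univ.inf ![A, B, C] = A ∩ B ∩ C := by
    simp [Fin.univ_succ, Finset.inf_insert, Finset.inter_assoc]
  rw [hinf, Set.mem_singleton_iff.1 hθ] at hi
  fin_cases i
  · left
    have : (2 * (A ∩ B ∩ C).card : ℚ) = A.card := by rw [hi]; simp
    exact_mod_cast this
  · right; left
    have : (2 * (A ∩ B ∩ C).card : ℚ) = B.card := by rw [hi]; simp
    exact_mod_cast this
  · right; right
    have : (2 * (A ∩ B ∩ C).card : ℚ) = C.card := by rw [hi]; simp
    exact_mod_cast this

/-- If `C` meets `A` in exactly half of `A`, every further member at least as large as `A` and `C`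
contains `A ∩ C`. -/
theorem IsBisectionClosed.inter_subset {n r : ℕ} {F : Finset (Finset (Fin n))}
    (h : IsBisectionClosed r F) (hr : 3 ≤ r) {A C D : Finset (Fin n)} (hA : A ∈ F) (hC : C ∈ F)
    (hD : D ∈ F) (hAC : A ≠ C) (hAD : A ≠ D) (hle : A.card ≤ C.card) (hle' : A.card ≤ D.card)
    (hhalf : 2 * (A ∩ C).card = A.card) : A ∩ C ⊆ D := by
  by_cases hCD : C = D
  · exact hCD ▸ Finset.inter_subset_right
  have h1 := h.triple hr hA hC hD hAC hAD hCD
  have h2 : (A ∩ C ∩ D).card ≤ (A ∩ C).card := Finset.card_le_card Finset.inter_subset_left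
  have h3 : A ∩ C ∩ D = A ∩ C :=
    Finset.eq_of_subset_of_card_le Finset.inter_subset_left (by omega)
  rw [← h3]
  exact Finset.inter_subset_right

/-- Half of a member `A`, avoiding `Z` and every larger member that meets `A` in half of `A`. -/
theorem IsBisectionClosed.exists_petal {n r : ℕ} {F : Finset (Finset (Fin n))}
    (h : IsBisectionClosed r F) (hr : 3 ≤ r) (Z : Finset (Fin n)) {A : Finset (Fin n)}
    (hA : A ∈ F) (heven : Even A.card) (hZ : 2 * (A ∩ Z).card ≤ A.card)
    (hZF : ∀ D ∈ F, A ≠ D → A.card ≤ D.card → A ∩ Z ⊆ D) :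
    ∃ P ⊆ A, Disjoint P Z ∧ 2 * P.card = A.card ∧
      ∀ D ∈ F, A ≠ D → A.card ≤ D.card → 2 * (A ∩ D).card = A.card → Disjoint P D := by
  by_cases hex : ∃ C ∈ F, A ≠ C ∧ A.card ≤ C.card ∧ 2 * (A ∩ C).card = A.card
  · obtain ⟨C, hC, hAC, hle, hhalf⟩ := hex
    have hcard := Finset.card_sdiff_add_card_inter A C
    -- One `C` serves every such `D`: `inter_subset` puts `A ∩ D` inside `C`.
    refine ⟨A \ C, Finset.sdiff_subset, ?_, by omega, ?_⟩
    · rw [Finset.disjoint_left]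
      intro x hx hxZ
      rw [Finset.mem_sdiff] at hx
      exact hx.2 (hZF C hC hAC hle (Finset.mem_inter.2 ⟨hx.1, hxZ⟩))
    · intro D hD hAD hleD hhalfD
      have hsub := h.inter_subset hr hA hD hC hAD hAC hleD hle hhalfD
      rw [Finset.disjoint_left]
      intro x hx hxD
      rw [Finset.mem_sdiff] at hx
      exact hx.2 (hsub (Finset.mem_inter.2 ⟨hx.1, hxD⟩))
  · push Not at hex
    obtain ⟨k, hk⟩ := heven
    have hcard := Finset.card_sdiff_add_card_inter A Z
    obtain ⟨P, hP, hPc⟩ := Finset.exists_subset_card_eq (s := A \ Z) (n := k) (by omega)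
    refine ⟨P, hP.trans Finset.sdiff_subset,
      Finset.disjoint_of_subset_left hP Finset.sdiff_disjoint, by omega, ?_⟩
    intro D hD hAD hle hhalf
    exact absurd hhalf (hex D hD hAD hle)

/-! ### Weights on points and the counting inequality. -/

/-- The sum decreases in a: a step removes 1/a and adds 1/(2a+1) + 1/(2a+2) ≤ 1/a. At a = 3 it
equals 19/20. -/
theorem sum_inv_Icc_le {a : ℕ} (ha : 3 ≤ a) :
    ∑ c ∈ Finset.Icc a (2 * a), (1 / (c : ℚ)) ≤ 19 / 20 := by
  induction a, ha using Nat.le_induction with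
  | base => norm_num [Finset.sum_Icc_succ_top]
  | succ a ha ih =>
    refine le_trans ?_ ih
    have h1 : ∑ c ∈ Finset.Icc a (2 * a), (1 / (c : ℚ))
        = 1 / (a : ℚ) + ∑ c ∈ Finset.Icc (a + 1) (2 * a), (1 / (c : ℚ)) := by
      rw [← Finset.sum_Ioc_add_eq_sum_Icc (by omega), add_comm]
      rw [Finset.Icc_add_one_left_eq_Ioc]
    have h2 : ∑ c ∈ Finset.Icc (a + 1) (2 * (a + 1)), (1 / (c : ℚ))
        = ∑ c ∈ Finset.Icc (a + 1) (2 * a), (1 / (c : ℚ)) + 1 / (2 * a + 1 : ℚ)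
          + 1 / (2 * a + 2 : ℚ) := by
      rw [show 2 * (a + 1) = 2 * a + 1 + 1 by ring, Finset.sum_Icc_succ_top (by omega),
        Finset.sum_Icc_succ_top (by omega)]
      push_cast
      ring_nf
    rw [h1, h2]
    have ha' : (0 : ℚ) < a := by exact_mod_cast (by omega : 0 < a)
    have h3 : 1 / (2 * a + 1 : ℚ) ≤ 1 / (2 * a) := by gcongr; linarith
    have h4 : 1 / (2 * a + 2 : ℚ) ≤ 1 / (2 * a) := by gcongr; linarith
    have h5 : 1 / (2 * a : ℚ) + 1 / (2 * a) = 1 / a := by field_simp; norm_num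
    linarith

theorem IsBisectionClosed.mono {n r : ℕ} {F G : Finset (Finset (Fin n))}
    (h : IsBisectionClosed r F) (hG : G ⊆ F) : IsBisectionClosed r G :=
  fun t ht htr A hA hAG => h t ht htr A hA fun i => hG (hAG i)

theorem sum_two_div_card_le {n m M : ℕ} {S : Finset (Finset (Fin n))}
    (heven : ∀ A ∈ S, Even A.card) (hinj : ∀ A ∈ S, ∀ D ∈ S, A.card = D.card → A = D)
    (hm : ∀ A ∈ S, 2 * m ≤ A.card) (hM : ∀ A ∈ S, A.card ≤ 2 * M) :
    ∑ A ∈ S, (2 / (A.card : ℚ)) ≤ ∑ c ∈ Finset.Icc m M, (1 / (c : ℚ)) := by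
  have himg : ∑ A ∈ S, (2 / (A.card : ℚ))
      = ∑ c ∈ S.image (fun A : Finset (Fin n) => A.card / 2), (1 / ((c : ℕ) : ℚ)) := by
    rw [Finset.sum_image]
    · refine Finset.sum_congr rfl fun A hA => ?_
      obtain ⟨k, hk⟩ := heven A hA
      have hk2 : A.card / 2 = k := by omega
      rw [hk2, hk]
      push_cast
      rw [← two_mul, ← div_div, div_self two_ne_zero]
    · intro A hA D hD hAD
      obtain ⟨k, hk⟩ := heven A hA
      obtain ⟨l, hl⟩ := heven D hD
      exact hinj A hA D hD (by dsimp only at hAD; omega)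
  rw [himg]
  refine Finset.sum_le_sum_of_subset_of_nonneg ?_ fun _ _ _ => by positivity
  intro c hc
  obtain ⟨A, hA, rfl⟩ := Finset.mem_image.1 hc
  have h1 := hm A hA
  have h2 := hM A hA
  rw [Finset.mem_Icc]
  omega

theorem card_biUnion_filter_card {n k : ℕ} {F : Finset (Finset (Fin n))}
    {P : Finset (Fin n) → Finset (Fin n)} (hcard : ∀ A ∈ F, 2 * (P A).card = A.card)
    (hdisj : ∀ A ∈ F, ∀ D ∈ F, A ≠ D → A.card = D.card → Disjoint (P A) (P D)) :
    ((F.filter fun A => A.card = 2 * k).biUnion P).card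
      = k * (F.filter fun A => A.card = 2 * k).card := by
  rw [Finset.card_biUnion]
  · rw [Finset.sum_congr rfl (g := fun _ => k), Finset.sum_const, smul_eq_mul, mul_comm]
    intro A hA
    rw [Finset.mem_filter] at hA
    have := hcard A hA.1
    omega
  · intro A hA D hD hAD
    simp only [Finset.coe_filter, Set.mem_ofPred_eq] at hA hD
    exact hdisj A hA.1 D hD.1 hAD (by omega)

/-- Off `Z`, p counts the points in petals of both a 2-set and a 4-set, q those of a 2-set only, s
those of a 4-set only, and u the rest. Members of size at least 6 put no weight on the first two
kinds, at most 35/60 on the third and 57/60 on the last. -/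
theorem IsBisectionClosed.exists_counts {n r : ℕ} {F : Finset (Finset (Fin n))}
    (h : IsBisectionClosed r F) (hr : 3 ≤ r) (heven : ∀ A ∈ F, Even A.card)
    (Z : Finset (Fin n)) (hZ : ∀ A ∈ F, 2 * (A ∩ Z).card ≤ A.card)
    (hZF : ∀ A ∈ F, ∀ D ∈ F, A ≠ D → A.card ≤ D.card → A ∩ Z ⊆ D) :
    ∃ p q s u : ℕ, p + q + s + u + Z.card = n ∧
      (F.filter fun A => A.card = 2).card = p + q ∧
      2 * (F.filter fun A => A.card = 4).card = p + s ∧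
      60 * (F.filter fun A => 6 ≤ A.card).card ≤ 35 * s + 57 * u ∧
      ((F.filter fun A => A.card = 4).card = 0 ∨
        2 * (F.filter fun A => A.card = 4).card + 2 ≤ n) := by
  have hex : ∀ A, ∃ P, A ∈ F → P ⊆ A ∧ Disjoint P Z ∧ 2 * P.card = A.card ∧
      ∀ D ∈ F, A ≠ D → A.card ≤ D.card → 2 * (A ∩ D).card = A.card → Disjoint P D := by
    intro A
    by_cases hA : A ∈ F
    · obtain ⟨P, h1, h2⟩ := h.exists_petal hr Z hA (heven A hA) (hZ A hA) (hZF A hA)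
      exact ⟨P, fun _ => ⟨h1, h2⟩⟩
    · exact ⟨∅, fun hA' => absurd hA' hA⟩
  choose P hP using hex
  have hsub := fun A hA => (hP A hA).1
  have hPZ := fun A hA => (hP A hA).2.1
  have hcard := fun A hA => (hP A hA).2.2.1
  have hsep := fun A hA => (hP A hA).2.2.2
  have hsame : ∀ A ∈ F, ∀ D ∈ F, A ≠ D → A.card = D.card → Disjoint (P A) D := by
    intro A hA D hD hAD hc
    refine hsep A hA D hD hAD hc.le ?_
    have := h.pair (by omega) hA hD hAD
    omega
  have hsame' : ∀ A ∈ F, ∀ D ∈ F, A ≠ D → A.card = D.card → Disjoint (P A) (P D) :=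
    fun A hA D hD hAD hc => Finset.disjoint_of_subset_right (hsub D hD) (hsame A hA D hD hAD hc)
  -- A shared petal point rules out |A ∩ D| = |A|/2, so |D|/2 = |A ∩ D| ≤ |A|.
  have hload : ∀ x, ∀ A ∈ F, ∀ D ∈ F, A.card ≤ D.card → x ∈ P A → x ∈ P D →
      D.card ≤ 2 * A.card := by
    intro x A hA D hD hle hxA hxD
    by_cases hAD : A = D
    · rw [hAD]; omega
    have h1 := h.pair (by omega) hA hD hAD
    have h2 : (A ∩ D).card ≤ A.card := Finset.card_le_card Finset.inter_subset_left
    have h3 : 2 * (A ∩ D).card ≠ A.card := fun hh =>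
      Finset.disjoint_left.1 (hsep A hA D hD hAD hle hh) hxA (hsub D hD hxD)
    omega
  have hinj : ∀ x, ∀ A ∈ F, ∀ D ∈ F, x ∈ P A → x ∈ P D → A.card = D.card → A = D := by
    intro x A hA D hD hxA hxD hc
    by_contra hAD
    exact Finset.disjoint_left.1 (hsame' A hA D hD hAD hc) hxA hxD
  set T₁ := (F.filter fun A => A.card = 2).biUnion P with hT₁
  set T₂ := (F.filter fun A => A.card = 4).biUnion P with hT₂
  set E := F.filter fun A => 6 ≤ A.card with hE
  have hT₁c : T₁.card = (F.filter fun A => A.card = 2).card := by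
    simpa using card_biUnion_filter_card (k := 1) hcard hsame'
  have hT₂c : T₂.card = 2 * (F.filter fun A => A.card = 4).card := by
    simpa using card_biUnion_filter_card (k := 2) hcard hsame'
  have hT₁Z : Disjoint T₁ Z := by
    rw [hT₁, Finset.disjoint_biUnion_left]
    exact fun A hA => hPZ A (Finset.mem_filter.1 hA).1
  have hT₂Z : Disjoint T₂ Z := by
    rw [hT₂, Finset.disjoint_biUnion_left]
    exact fun A hA => hPZ A (Finset.mem_filter.1 hA).1
  have hc1 := Finset.card_inter_add_card_sdiff T₁ T₂
  have hc2 := Finset.card_inter_add_card_sdiff T₂ T₁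
  rw [Finset.inter_comm] at hc2
  have hc3 := Finset.card_compl_add_card (T₁ ∪ T₂ ∪ Z)
  rw [Fintype.card_fin, Finset.card_union_of_disjoint
    (Finset.disjoint_union_left.2 ⟨hT₁Z, hT₂Z⟩)] at hc3
  have hc4 := Finset.card_union_add_card_inter T₁ T₂
  refine ⟨(T₁ ∩ T₂).card, (T₁ \ T₂).card, (T₂ \ T₁).card, (T₁ ∪ T₂ ∪ Z)ᶜ.card, by omega,
    by omega, by omega, ?_, ?_⟩
  · have hsum : (E.card : ℚ) = ∑ x, ∑ A ∈ E.filter (fun A => x ∈ P A), (2 / (A.card : ℚ)) := by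
      rw [Finset.sum_congr rfl fun x _ => Finset.sum_filter _ _, Finset.sum_comm,
        Finset.card_eq_sum_ones, Nat.cast_sum]
      refine Finset.sum_congr rfl fun A hA => ?_
      rw [hE, Finset.mem_filter] at hA
      rw [← Finset.sum_filter, Finset.sum_const, Finset.filter_univ_mem, nsmul_eq_mul]
      have h1 : (2 * (P A).card : ℚ) = A.card := by exact_mod_cast hcard A hA.1
      have h2 : (A.card : ℚ) ≠ 0 := by
        have := hA.2
        exact_mod_cast (by omega : A.card ≠ 0)
      rw [Nat.cast_one, ← mul_div_assoc, mul_comm, h1, div_self h2]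
    have hpt : ∀ x, ∑ A ∈ E.filter (fun A => x ∈ P A), (2 / (A.card : ℚ))
        ≤ (if x ∈ T₂ \ T₁ then 35 / 60 else 0)
          + (if x ∈ (T₁ ∪ T₂ ∪ Z)ᶜ then 57 / 60 else 0) := by
      intro x
      have hnn : (0 : ℚ) ≤ (if x ∈ T₂ \ T₁ then 35 / 60 else 0)
          + (if x ∈ (T₁ ∪ T₂ ∪ Z)ᶜ then 57 / 60 else 0) := by
        split_ifs <;> norm_num
      have hmem : ∀ A ∈ E.filter (fun A => x ∈ P A), A ∈ F ∧ 6 ≤ A.card ∧ x ∈ P A := by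
        intro A hA
        rw [Finset.mem_filter, hE, Finset.mem_filter] at hA
        exact ⟨hA.1.1, hA.1.2, hA.2⟩
      rcases (E.filter (fun A => x ∈ P A)).eq_empty_or_nonempty with hS | hS
      · rw [hS, Finset.sum_empty]
        exact hnn
      obtain ⟨A₀, hA₀, hmin⟩ := Finset.exists_min_image _ Finset.card hS
      have hA₀' := hmem A₀ hA₀
      have hxZ : x ∉ Z := fun hx => Finset.disjoint_left.1 (hPZ A₀ hA₀'.1) hA₀'.2.2 hx
      have hxT₁ : x ∉ T₁ := by
        intro hx
        obtain ⟨D, hD, hxD⟩ := Finset.mem_biUnion.1 hx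
        rw [Finset.mem_filter] at hD
        have := hload x D hD.1 A₀ hA₀'.1 (by omega) hxD hA₀'.2.2
        omega
      have hgen : ∀ m M, (∀ A ∈ E.filter (fun A => x ∈ P A), 2 * m ≤ A.card) →
          (∀ A ∈ E.filter (fun A => x ∈ P A), A.card ≤ 2 * M) →
          ∑ A ∈ E.filter (fun A => x ∈ P A), (2 / (A.card : ℚ))
            ≤ ∑ c ∈ Finset.Icc m M, (1 / (c : ℚ)) := fun m M hm hM =>
        sum_two_div_card_le (fun A hA => heven A (hmem A hA).1)
          (fun A hA D hD => hinj x A (hmem A hA).1 D (hmem D hD).1 (hmem A hA).2.2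
            (hmem D hD).2.2) hm hM
      by_cases hxT₂ : x ∈ T₂
      · rw [if_pos (Finset.mem_sdiff.2 ⟨hxT₂, hxT₁⟩), if_neg (by simp [hxT₂])]
        obtain ⟨D, hD, hxD⟩ := Finset.mem_biUnion.1 hxT₂
        rw [Finset.mem_filter] at hD
        -- A point in the petal of a 4-set admits only sizes 6 and 8 here: 1/3 + 1/4 = 35/60.
        refine (hgen 3 4 (fun A hA => (hmem A hA).2.1) fun A hA => ?_).trans ?_
        · have h1 := hmem A hA
          have := hload x D hD.1 A h1.1 (by omega) hxD h1.2.2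
          omega
        · norm_num [Finset.sum_Icc_succ_top]
      · rw [if_neg (by simp [hxT₂]), if_pos (by simp [hxT₁, hxT₂, hxZ])]
        obtain ⟨k, hk⟩ := heven A₀ hA₀'.1
        refine (hgen k (2 * k) (fun A hA => ?_) fun A hA => ?_).trans
          ((sum_inv_Icc_le (by omega)).trans (by norm_num))
        · have := hmin A hA
          omega
        · have := hload x A₀ hA₀'.1 A (hmem A hA).1 (hmin A hA) hA₀'.2.2 (hmem A hA).2.2
          omega
    have hfin := Finset.sum_le_sum fun x (_ : x ∈ Finset.univ) => hpt x
    rw [← hsum, Finset.sum_add_distrib, ← Finset.sum_filter, ← Finset.sum_filter,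
      Finset.filter_univ_mem, Finset.filter_univ_mem, Finset.sum_const, Finset.sum_const,
      nsmul_eq_mul, nsmul_eq_mul] at hfin
    have : (60 * E.card : ℚ) ≤ 35 * (T₂ \ T₁).card + 57 * (T₁ ∪ T₂ ∪ Z)ᶜ.card := by linarith
    exact_mod_cast this
  · rcases (F.filter fun A => A.card = 4).eq_empty_or_nonempty with h4 | ⟨A, hA⟩
    · left
      rw [h4, Finset.card_empty]
    · right
      rw [Finset.mem_filter] at hA
      -- The other half of one 4-set supplies two points outside all petals of 4-sets.
      have hdisj : Disjoint T₂ (A \ P A) := by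
        rw [hT₂, Finset.disjoint_biUnion_left]
        intro D hD
        rw [Finset.mem_filter] at hD
        by_cases hDA : D = A
        · rw [hDA]
          exact Finset.disjoint_sdiff
        · exact Finset.disjoint_of_subset_right Finset.sdiff_subset
            (hsame D hD.1 A hA.1 hDA (by omega))
      have h1 := Finset.card_sdiff_add_card_eq_card (hsub A hA.1)
      have h2 := hcard A hA.1
      have h3 := Finset.card_le_univ (T₂ ∪ A \ P A)
      rw [Finset.card_union_of_disjoint hdisj, Fintype.card_fin] at h3
      omega

/-! ### Size bounds and the sizes of members in large families. -/

theorem card_eq_add_of_even {n : ℕ} {F : Finset (Finset (Fin n))}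
    (hne : ∀ A ∈ F, A.Nonempty) (heven : ∀ A ∈ F, Even A.card) :
    F.card = (F.filter fun A => A.card = 2).card + (F.filter fun A => A.card = 4).card
      + (F.filter fun A => 6 ≤ A.card).card := by
  rw [← Finset.card_union_of_disjoint, ← Finset.filter_or, ← Finset.card_union_of_disjoint,
    ← Finset.filter_or, Finset.filter_true_of_mem]
  · intro A hA
    have h1 := (hne A hA).card_pos
    obtain ⟨k, hk⟩ := heven A hA
    omega
  · refine Finset.disjoint_filter.2 fun A _ _ => ?_
    omega
  · refine Finset.disjoint_filter.2 fun A _ _ => ?_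
    omega

/-- Two 2-sets meet in a single point x. A member missing x would make a triple intersection empty,
yet it must be half of a nonempty set. -/
theorem IsBisectionClosed.exists_common {n r : ℕ} {F : Finset (Finset (Fin n))}
    (h : IsBisectionClosed r F) (hr : 3 ≤ r) (hne : ∀ A ∈ F, A.Nonempty)
    (h2 : 2 ≤ (F.filter fun A => A.card = 2).card) : ∃ x, ∀ A ∈ F, x ∈ A := by
  obtain ⟨A, hA, B, hB, hAB⟩ := Finset.one_lt_card.1 h2
  rw [Finset.mem_filter] at hA hB
  have hp := h.pair (by omega) hA.1 hB.1 hAB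
  obtain ⟨x, hx⟩ := Finset.card_eq_one.1 (show (A ∩ B).card = 1 by omega)
  have hxm : x ∈ A ∩ B := by simp [hx]
  rw [Finset.mem_inter] at hxm
  refine ⟨x, fun D hD => ?_⟩
  by_cases hAD : A = D
  · exact hAD ▸ hxm.1
  by_cases hBD : B = D
  · exact hBD ▸ hxm.2
  have ht := h.triple hr hA.1 hB.1 hD hAB hAD hBD
  have hpos := (hne D hD).card_pos
  rw [hx] at ht
  by_contra hxD
  rw [Finset.singleton_inter_of_notMem hxD, Finset.card_empty] at ht
  omega

/-- A singleton {v} cannot be halved, so every other member is a 2-set through v. -/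
theorem IsBisectionClosed.card_le_of_singleton {n r : ℕ} {F : Finset (Finset (Fin n))}
    (h : IsBisectionClosed r F) (hr : 3 ≤ r) (hne : ∀ A ∈ F, A.Nonempty) {A : Finset (Fin n)}
    (hA : A ∈ F) (hc : A.card = 1) : F.card ≤ n := by
  obtain ⟨v, rfl⟩ := Finset.card_eq_one.1 hc
  have hF : ∀ D ∈ F.erase {v}, v ∈ D ∧ D.card = 2 := by
    intro D hD
    rw [Finset.mem_erase] at hD
    have hp := h.pair (by omega) hA hD.2 hD.1.symm
    have hpos := (hne D hD.2).card_pos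
    by_cases hv : v ∈ D
    · rw [Finset.singleton_inter_of_mem hv, Finset.card_singleton] at hp
      exact ⟨hv, by omega⟩
    · rw [Finset.singleton_inter_of_notMem hv, Finset.card_empty] at hp
      omega
  obtain ⟨p, q, s, u, h1, h2, -, -, -⟩ := (h.mono (Finset.erase_subset {v} F)).exists_counts hr
    (fun D hD => by rw [(hF D hD).2]; exact even_two) {v}
    (fun D hD => by
      have := Finset.card_le_card (Finset.inter_subset_right (s₁ := D) (s₂ := {v}))
      rw [Finset.card_singleton] at this
      have := (hF D hD).2
      omega)
    (fun D _ D' hD' _ _ => by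
      intro y hy
      rw [Finset.mem_inter, Finset.mem_singleton] at hy
      rw [hy.2]
      exact (hF D' hD').1)
  rw [Finset.filter_true_of_mem fun D hD => (hF D hD).2, Finset.card_erase_of_mem hA] at h2
  rw [Finset.card_singleton] at h1
  omega

/-- A member of odd size meets every other member in half of the latter. -/
theorem IsBisectionClosed.of_odd {n r : ℕ} {F : Finset (Finset (Fin n))}
    (h : IsBisectionClosed r F) (hr : 2 ≤ r) {O A : Finset (Fin n)} (hO : O ∈ F)
    (hodd : ¬ Even O.card) (hA : A ∈ F) (hAO : A ≠ O) : 2 * (A ∩ O).card = A.card := by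
  rcases h.pair hr hA hO hAO with h1 | h1
  · exact h1
  · exact absurd ⟨(A ∩ O).card, by omega⟩ hodd

/-- By `exists_counts` the even members number at most 3p/2 + q + 13s/12 + 19u/20. The second clause
serves uniqueness and the third robustness, where 14/10 = 3/2 - 1/10. -/
theorem IsBisectionClosed.card_structure {n r : ℕ} (hn : 2 ≤ n) {F : Finset (Finset (Fin n))}
    (h : IsBisectionClosed r F) (hr : 3 ≤ r) (hne : ∀ A ∈ F, A.Nonempty)
    (hone : ∀ A ∈ F, A.card ≠ 1) :
    2 * F.card + 4 ≤ 3 * n ∧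
    (3 * n ≤ 2 * F.card + 5 → n = 2 ∨
      (2 ≤ (F.filter fun A => A.card = 2).card ∧ ∀ A ∈ F, A.card = 2 ∨ A.card = 4)) ∧
    (14 * n ≤ 10 * F.card → 2 ≤ (F.filter fun A => A.card = 2).card ∧
      (F.filter fun A => ¬ (A.card = 2 ∨ A.card = 4)).card + 2 * F.card ≤ 3 * n) := by
  have hbad : (F.filter fun A => ¬ (A.card = 2 ∨ A.card = 4)).card
      + (F.filter fun A => A.card = 2).card + (F.filter fun A => A.card = 4).card = F.card := by
    rw [add_assoc, ← Finset.card_union_of_disjoint, ← Finset.filter_or, add_comm,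
      Finset.card_filter_add_card_filter_not]
    refine Finset.disjoint_filter.2 fun A _ _ => ?_
    omega
  have hall : (F.filter fun A => ¬ (A.card = 2 ∨ A.card = 4)).card = 0 →
      ∀ A ∈ F, A.card = 2 ∨ A.card = 4 := by
    intro h0 A hA
    rw [Finset.card_eq_zero, Finset.filter_eq_empty_iff] at h0
    exact not_not.1 (h0 hA)
  by_cases hodd : ∃ O ∈ F, ¬ Even O.card
  · obtain ⟨O, hO, hOodd⟩ := hodd
    have hhalf : ∀ A ∈ F.erase O, 2 * (A ∩ O).card = A.card := by
      intro A hA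
      rw [Finset.mem_erase] at hA
      exact h.of_odd (by omega) hO hOodd hA.2 hA.1
    have heven : ∀ A ∈ F.erase O, Even A.card := fun A hA =>
      ⟨(A ∩ O).card, by have := hhalf A hA; omega⟩
    have hcl := h.mono (Finset.erase_subset O F)
    have hcard := card_eq_add_of_even (fun A hA => hne A (Finset.mem_of_mem_erase hA)) heven
    -- With `Z = O` all petals avoid `O`, which has at least three points.
    obtain ⟨p, q, s, u, h1, h2, h3, h4, h5⟩ := hcl.exists_counts hr heven O
      (fun A hA => (hhalf A hA).le) (by
        intro A hA D hD hAD hle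
        have hA' := Finset.mem_erase.1 hA
        have hD' := Finset.mem_erase.1 hD
        have ht := h.triple hr hA'.2 hO hD'.2 hA'.1 hAD hD'.1.symm
        have hhA := hhalf A hA
        have hsub : A ∩ O ∩ D ⊆ A ∩ O := Finset.inter_subset_left
        have hle2 := Finset.card_le_card hsub
        have h3 : A ∩ O ∩ D = A ∩ O := by
          refine Finset.eq_of_subset_of_card_le hsub ?_
          rcases ht with ht | ht | ht
          · omega
          · exact absurd ⟨(A ∩ O ∩ D).card, by omega⟩ hOodd
          · omega
        rw [← h3]
        exact Finset.inter_subset_right)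
    have hO3 : 3 ≤ O.card := by
      have h6 := (hne O hO).card_pos
      have h7 := hone O hO
      by_contra h8
      exact hOodd ⟨1, by omega⟩
    have hO2 : O.card ≠ 2 := fun hc => hOodd ⟨1, by omega⟩
    have hO4 : O.card ≠ 4 := fun hc => hOodd ⟨2, by omega⟩
    have hf2 : (F.erase O).filter (fun A => A.card = 2) = F.filter fun A => A.card = 2 := by
      rw [Finset.filter_erase, Finset.erase_eq_of_notMem (by simp [hO2])]
    have hf4 : (F.erase O).filter (fun A => A.card = 4) = F.filter fun A => A.card = 4 := by
      rw [Finset.filter_erase, Finset.erase_eq_of_notMem (by simp [hO4])]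
    have hFpos := Finset.card_pos.2 ⟨O, hO⟩
    rw [Finset.card_erase_of_mem hO] at hcard
    rw [hf2] at hcard h2
    rw [hf4] at hcard h3 h5
    refine ⟨by omega, fun _ => by omega, fun _ => by omega⟩
  · push Not at hodd
    have hcard := card_eq_add_of_even hne hodd
    by_cases hn1 : 2 ≤ (F.filter fun A => A.card = 2).card
    · obtain ⟨x, hx⟩ := h.exists_common hr hne hn1
      obtain ⟨p, q, s, u, h1, h2, h3, h4, h5⟩ := h.exists_counts hr hodd {x}
        (fun A hA => by
          have h6 := Finset.card_le_card (Finset.inter_subset_right (s₁ := A) (s₂ := {x}))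
          rw [Finset.card_singleton] at h6
          have h7 := (hne A hA).card_pos
          have h8 := hone A hA
          omega)
        (fun A _ D hD _ _ => by
          intro y hy
          rw [Finset.mem_inter, Finset.mem_singleton] at hy
          rw [hy.2]
          exact hx D hD)
      rw [Finset.card_singleton] at h1
      -- In the last clause a member of size at least 6 counts three times; the points still carry
      -- at most 3, 2, 11/4 and 57/20, all at most 3.
      refine ⟨by omega, fun h6 => Or.inr ⟨hn1, hall ?_⟩, fun _ => ⟨hn1, by omega⟩⟩
      -- The coefficients are 60 times the shortfalls of 13/12, 1 and 19/20 from 3/2.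
      have h7 : 25 * s + 30 * q + 33 * u ≤ 60 := by omega
      have h8 : 1 ≤ q + u := by omega
      -- Here p + s = n - 2 is even, so parity sharpens the assumed inequality by one.
      have h9 : q + u = 1 → 25 * s + 30 * q + 33 * u ≤ 30 := by omega
      have h10 : s = 0 ∧ u = 0 := by omega
      omega
    · obtain ⟨p, q, s, u, h1, h2, h3, h4, h5⟩ := h.exists_counts hr hodd ∅
        (by simp) (by simp)
      rw [Finset.card_empty] at h1
      -- The counts alone do not settle the smallest n.
      have h6 : n ≤ 5 → (F.filter fun A => 6 ≤ A.card).card = 0 := by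
        intro hn5
        rw [Finset.card_eq_zero, Finset.filter_eq_empty_iff]
        intro A _
        have := Finset.card_le_univ A
        rw [Fintype.card_fin] at this
        omega
      refine ⟨by omega, fun _ => by omega, fun _ => by omega⟩

/-! ### Relabelling the 2-sets and 4-sets into `maxFamily`. -/

theorem exists_perm_comp_eq {ι α : Type*} [Finite α] {f g : ι → α} (hf : Function.Injective f)
    (hg : Function.Injective g) : ∃ σ : Equiv.Perm α, ∀ i, σ (f i) = g i := by
  classical
  have := Fintype.ofFinite α
  let e : {x // x ∈ Set.range f} ≃ {x // x ∈ Set.range g} :=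
    (Equiv.ofInjective f hf).symm.trans (Equiv.ofInjective g hg)
  refine ⟨e.extendSubtype, fun i => ?_⟩
  rw [e.extendSubtype_apply_of_mem (f i) ⟨i, rfl⟩]
  have : (⟨f i, ⟨i, rfl⟩⟩ : {x // x ∈ Set.range f}) = Equiv.ofInjective f hf i := rfl
  simp only [e, Equiv.trans_apply]
  rw [this, Equiv.symm_apply_apply]
  rfl

theorem mem_maxFamily {n : ℕ} {A : Finset (Fin n)} : A ∈ maxFamily n ↔
    (∃ a b : Fin n, a.val = 0 ∧ 1 ≤ b.val ∧ A = {a, b}) ∨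
    (∃ (k : ℕ) (a b c d : Fin n), 1 ≤ k ∧ a.val = 0 ∧ b.val = 1 ∧ c.val = 2 * k ∧
      d.val = 2 * k + 1 ∧ A = {a, b, c, d}) := by
  classical
  simp [maxFamily]

theorem card_permFamily {n : ℕ} (σ : Equiv.Perm (Fin n)) (F : Finset (Finset (Fin n))) :
    (permFamily σ F).card = F.card :=
  Finset.card_image_of_injective _ (Finset.image_injective σ.injective)

/-- The members of size four share two points, one of which may be prescribed. -/
theorem IsBisectionClosed.exists_second {n r : ℕ} (hn : 2 ≤ n) {F : Finset (Finset (Fin n))}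
    (h : IsBisectionClosed r F) (hr : 3 ≤ r) {x : Fin n} (hx : ∀ A ∈ F, x ∈ A) :
    ∃ y, y ≠ x ∧ (∀ A ∈ F, A.card = 4 → y ∈ A) ∧
      ∀ A ∈ F, ∀ B ∈ F, A.card = 4 → B.card = 4 → A ≠ B → A ∩ B = {x, y} := by
  by_cases hex : ∃ A ∈ F, ∃ B ∈ F, A.card = 4 ∧ B.card = 4 ∧ A ≠ B
  · obtain ⟨A, hA, B, hB, hA4, hB4, hAB⟩ := hex
    have hp := h.pair (by omega) hA hB hAB
    obtain ⟨y, hy, hyx⟩ := Finset.exists_mem_ne (show 1 < (A ∩ B).card by omega) x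
    have hyAB := Finset.mem_inter.1 hy
    have hmem : ∀ D ∈ F, D.card = 4 → y ∈ D := by
      intro D hD hD4
      by_cases hAD : A = D
      · exact hAD ▸ hyAB.1
      · exact h.inter_subset hr hA hB hD hAB hAD (by omega) (by omega) (by omega) hy
    refine ⟨y, hyx, hmem, fun D hD E hE hD4 hE4 hDE => ?_⟩
    have hp' := h.pair (by omega) hD hE hDE
    symm
    apply Finset.eq_of_subset_of_card_le
    · intro z hz
      rw [Finset.mem_insert, Finset.mem_singleton] at hz
      rcases hz with rfl | rfl
      · exact Finset.mem_inter.2 ⟨hx D hD, hx E hE⟩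
      · exact Finset.mem_inter.2 ⟨hmem D hD hD4, hmem E hE hE4⟩
    · rw [Finset.card_pair hyx.symm]
      omega
  · push Not at hex
    by_cases h4 : ∃ A ∈ F, A.card = 4
    · obtain ⟨A, hA, hA4⟩ := h4
      obtain ⟨y, hy, hyx⟩ := Finset.exists_mem_ne (show 1 < A.card by omega) x
      refine ⟨y, hyx, fun D hD hD4 => ?_, fun D hD E hE hD4 hE4 hDE =>
        absurd (hex D hD E hE hD4 hE4) hDE⟩
      rw [← hex A hA D hD hA4 hD4]
      exact hy
    · push Not at h4
      have : Nontrivial (Fin n) := Fin.nontrivial_iff_two_le.2 hn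
      obtain ⟨y, hy⟩ := exists_ne x
      exact ⟨y, hy, fun A hA hA4 => absurd hA4 (h4 A hA),
        fun A hA _ _ hA4 => absurd hA4 (h4 A hA)⟩

/-- Removing the common pair {x, y} leaves disjoint pairs from the 4-sets. So x ↦ 0, y ↦ 1, with the
pairs sent to the blocks {2k, 2k+1}, extends to a permutation; the 2-sets through x then need no
further care. -/
theorem IsBisectionClosed.exists_perm {n r : ℕ} (hn : 2 ≤ n) {F : Finset (Finset (Fin n))}
    (h : IsBisectionClosed r F) (hr : 3 ≤ r) {x : Fin n} (hx : ∀ A ∈ F, x ∈ A) :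
    ∃ σ : Equiv.Perm (Fin n), ∀ A ∈ F, A.card = 2 ∨ A.card = 4 → A.image σ ∈ maxFamily n := by
  obtain ⟨y, hyx, hy, hinter⟩ := h.exists_second hn hr hx
  set G := F.filter fun A => A.card = 4 with hG
  have hGF : ∀ A : G, A.1 ∈ F ∧ A.1.card = 4 := fun A => Finset.mem_filter.1 A.2
  have hpair : ∀ A : G, ∃ u v, u ≠ v ∧ (A.1.erase x).erase y = {u, v} := by
    intro A
    have h1 := hGF A
    have h2 := Finset.card_erase_of_mem (hx A.1 h1.1)
    have h3 := Finset.card_erase_of_mem (Finset.mem_erase.2 ⟨hyx, hy A.1 h1.1 h1.2⟩)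
    exact Finset.card_eq_two.1 (by omega)
  choose u v huv hA using hpair
  have hu : ∀ A, u A ≠ y ∧ u A ≠ x ∧ u A ∈ A.1 := fun A => by
    have : u A ∈ (A.1.erase x).erase y := by simp [hA]
    simpa only [Finset.mem_erase] using this
  have hv : ∀ A, v A ≠ y ∧ v A ≠ x ∧ v A ∈ A.1 := fun A => by
    have : v A ∈ (A.1.erase x).erase y := by simp [hA]
    simpa only [Finset.mem_erase] using this
  have hset : ∀ A, A.1 = {x, y, u A, v A} := fun A => by
    rw [← hA, Finset.insert_erase, Finset.insert_erase (hx A.1 (hGF A).1)]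
    exact Finset.mem_erase.2 ⟨hyx, hy A.1 (hGF A).1 (hGF A).2⟩
  have hsep : ∀ A B : G, ∀ z, z ≠ y → z ≠ x → z ∈ A.1 → z ∈ B.1 → A = B := by
    intro A B z hzy hzx hzA hzB
    by_contra hAB
    have h1 := hinter A.1 (hGF A).1 B.1 (hGF B).1 (hGF A).2 (hGF B).2
      (fun hh => hAB (Subtype.ext hh))
    have h2 : z ∈ A.1 ∩ B.1 := Finset.mem_inter.2 ⟨hzA, hzB⟩
    rw [h1, Finset.mem_insert, Finset.mem_singleton] at h2
    exact h2.elim hzx hzy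
  let e := G.equivFin
  let f : Bool ⊕ (G × Bool) → Fin n :=
    Sum.elim (fun b => bif b then x else y) (fun p => bif p.2 then u p.1 else v p.1)
  have hf : Function.Injective f := by
    rintro (b | ⟨A, b⟩) (c | ⟨B, c⟩) hfe
    · cases b <;> cases c <;> simp [f, hyx, hyx.symm] at hfe ⊢
    · cases b <;> cases c <;>
        simp [f, (hu B).1.symm, (hu B).2.1.symm, (hv B).1.symm, (hv B).2.1.symm] at hfe
    · cases b <;> cases c <;>
        simp [f, (hu A).1, (hu A).2.1, (hv A).1, (hv A).2.1] at hfe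
    · have hAB : A = B := by
        cases b <;> cases c <;> simp only [f, Sum.elim_inr, cond_true, cond_false] at hfe
        · exact hsep A B (v A) (hv A).1 (hv A).2.1 (hv A).2.2 (hfe ▸ (hv B).2.2)
        · exact hsep A B (v A) (hv A).1 (hv A).2.1 (hv A).2.2 (hfe ▸ (hu B).2.2)
        · exact hsep A B (u A) (hu A).1 (hu A).2.1 (hu A).2.2 (hfe ▸ (hv B).2.2)
        · exact hsep A B (u A) (hu A).1 (hu A).2.1 (hu A).2.2 (hfe ▸ (hu B).2.2)
      subst hAB
      cases b <;> cases c <;> simp [f, huv A, (huv A).symm] at hfe ⊢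
  have hle : 2 * G.card + 2 ≤ n := by
    have := Fintype.card_le_of_injective f hf
    simp only [Fintype.card_sum, Fintype.card_prod, Fintype.card_bool, Fintype.card_coe,
      Fintype.card_fin] at this
    omega
  -- The shift by one is there because the blocks start at k = 1.
  let g : Bool ⊕ (G × Bool) → Fin n :=
    Sum.elim (fun b => bif b then ⟨0, by omega⟩ else ⟨1, by omega⟩)
      (fun p => bif p.2 then ⟨2 * (e p.1 + 1), by have := (e p.1).2; omega⟩
        else ⟨2 * (e p.1 + 1) + 1, by have := (e p.1).2; omega⟩)
  have hg : Function.Injective g := by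
    rintro (b | ⟨A, b⟩) (c | ⟨B, c⟩) hge
    · cases b <;> cases c <;> simp [g] at hge ⊢
    · cases b <;> cases c <;>
        simp only [g, Sum.elim_inl, Sum.elim_inr, cond_true, cond_false, Fin.mk.injEq] at hge <;>
        omega
    · cases b <;> cases c <;>
        simp only [g, Sum.elim_inl, Sum.elim_inr, cond_true, cond_false, Fin.mk.injEq] at hge <;>
        omega
    · have hval : (e A).val = (e B).val ∧ b = c := by
        cases b <;> cases c <;>
          simp only [g, Sum.elim_inr, cond_true, cond_false, Fin.mk.injEq] at hge <;>
          simp <;> omega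
      rw [e.injective (Fin.ext hval.1), hval.2]
  obtain ⟨σ, hσ⟩ := exists_perm_comp_eq hf hg
  have hσx : σ x = ⟨0, by omega⟩ := hσ (Sum.inl true)
  have hσy : σ y = ⟨1, by omega⟩ := hσ (Sum.inl false)
  refine ⟨σ, fun A hAF hc => mem_maxFamily.2 ?_⟩
  rcases hc with hc | hc
  · left
    obtain ⟨z, hz⟩ := Finset.card_eq_one.1
      (show (A.erase x).card = 1 by rw [Finset.card_erase_of_mem (hx A hAF), hc])
    have hzx : z ≠ x := (Finset.mem_erase.1 (show z ∈ A.erase x by simp [hz])).1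
    refine ⟨σ x, σ z, by rw [hσx], ?_, ?_⟩
    · by_contra hlt
      refine hzx (σ.injective (Fin.ext ?_))
      rw [hσx]
      dsimp only
      omega
    · rw [← Finset.insert_erase (hx A hAF), hz, Finset.image_insert, Finset.image_singleton]
  · right
    let B : G := ⟨A, Finset.mem_filter.2 ⟨hAF, hc⟩⟩
    refine ⟨e B + 1, σ x, σ y, σ (u B), σ (v B), by omega, by rw [hσx], by rw [hσy], ?_, ?_, ?_⟩
    · exact congrArg Fin.val (hσ (Sum.inr (B, true)))
    · exact congrArg Fin.val (hσ (Sum.inr (B, false)))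
    · rw [show A = _ from hset B]
      simp only [Finset.image_insert, Finset.image_singleton]

/-! ### The extremal family: closedness and size. -/

theorem zero_mem_of_mem_maxFamily {n : ℕ} (hn : 2 ≤ n) {A : Finset (Fin n)}
    (hA : A ∈ maxFamily n) : (⟨0, by omega⟩ : Fin n) ∈ A := by
  rcases mem_maxFamily.1 hA with ⟨a, b, ha, hb, rfl⟩ | ⟨k, a, b, c, d, hk, ha, hb, hc, hd, rfl⟩ <;>
    simp [Fin.ext_iff, ha]

theorem card_of_mem_maxFamily {n : ℕ} {A : Finset (Fin n)} (hA : A ∈ maxFamily n) :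
    A.card = 2 ∨ A.card = 4 := by
  rcases mem_maxFamily.1 hA with ⟨a, b, ha, hb, rfl⟩ | ⟨k, a, b, c, d, hk, ha, hb, hc, hd, rfl⟩
  · left
    exact Finset.card_pair fun hh => by rw [hh] at ha; omega
  · right
    rw [Finset.card_insert_of_notMem, Finset.card_insert_of_notMem, Finset.card_pair]
    all_goals simp only [Finset.mem_insert, Finset.mem_singleton, Fin.ext_iff, ne_eq]
    all_goals omega

theorem inter_of_mem_maxFamily_two {n : ℕ} (hn : 2 ≤ n) {A B : Finset (Fin n)}
    (hA : A ∈ maxFamily n) (hB : B ∈ maxFamily n) (hAB : A ≠ B) (hA2 : A.card = 2)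
    (hB2 : B.card = 2) : (A ∩ B).card = 1 := by
  have h1 : (⟨0, by omega⟩ : Fin n) ∈ A ∩ B := Finset.mem_inter.2
    ⟨zero_mem_of_mem_maxFamily hn hA, zero_mem_of_mem_maxFamily hn hB⟩
  have h2 := Finset.card_pos.2 ⟨_, h1⟩
  by_contra hne
  have h3 := Finset.eq_of_subset_of_card_le (Finset.inter_subset_left (s₁ := A) (s₂ := B))
    (by omega)
  have h4 := Finset.eq_of_subset_of_card_le (Finset.inter_subset_right (s₁ := A) (s₂ := B))
    (by omega)
  exact hAB (h3.symm.trans h4)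

theorem one_mem_of_mem_maxFamily {n : ℕ} (hn : 2 ≤ n) {A : Finset (Fin n)}
    (hA : A ∈ maxFamily n) (hA4 : A.card = 4) : (⟨1, by omega⟩ : Fin n) ∈ A := by
  rcases mem_maxFamily.1 hA with ⟨a, b, ha, hb, rfl⟩ | ⟨k, a, b, c, d, hk, ha, hb, hc, hd, rfl⟩
  · have := Finset.card_le_two (a := a) (b := b)
    omega
  · simp [Fin.ext_iff, hb]

theorem inter_of_mem_maxFamily_four {n : ℕ} (hn : 2 ≤ n) {A B : Finset (Fin n)}
    (hA : A ∈ maxFamily n) (hB : B ∈ maxFamily n) (hAB : A ≠ B) (hA4 : A.card = 4)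
    (hB4 : B.card = 4) :
    A ∩ B ⊆ ({⟨0, by omega⟩, ⟨1, by omega⟩} : Finset (Fin n)) := by
  rcases mem_maxFamily.1 hA with ⟨a, b, ha, hb, rfl⟩ | ⟨k, a, b, c, d, hk, ha, hb, hc, hd, rfl⟩
  · have := Finset.card_le_two (a := a) (b := b)
    omega
  rcases mem_maxFamily.1 hB with ⟨a', b', ha', hb', rfl⟩ |
    ⟨l, a', b', c', d', hl, ha', hb', hc', hd', rfl⟩
  · have := Finset.card_le_two (a := a') (b := b')
    omega
  have hkl : k ≠ l := by
    rintro rfl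
    rw [Fin.ext (ha.trans ha'.symm), Fin.ext (hb.trans hb'.symm), Fin.ext (hc.trans hc'.symm),
      Fin.ext (hd.trans hd'.symm)] at hAB
    exact hAB rfl
  intro z hz
  simp only [Finset.mem_inter, Finset.mem_insert, Finset.mem_singleton, Fin.ext_iff] at hz ⊢
  omega

/-- Every intersection contains 0. If both sizes occur, it has one or two points, half of the 2-set
or half of the 4-set. If only one size occurs, it is {0} or {0, 1}. -/
theorem isBisectionClosed_maxFamily {n : ℕ} (hn : 2 ≤ n) (r : ℕ) :
    IsBisectionClosed r (maxFamily n) := by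
  intro t ht _ A hinj hA
  set I := Finset.univ.inf A with hI
  have hIle : ∀ i, I ⊆ A i := fun i => Finset.inf_le (Finset.mem_univ i)
  have hI0 : (⟨0, by omega⟩ : Fin n) ∈ I := by
    rw [← Finset.singleton_subset_iff]
    exact Finset.le_inf fun i _ =>
      Finset.singleton_subset_iff.2 (zero_mem_of_mem_maxFamily hn (hA i))
  have hIpos := Finset.card_pos.2 ⟨_, hI0⟩
  suffices hs : ∃ i, 2 * I.card = (A i).card by
    obtain ⟨i, hi⟩ := hs
    refine ⟨i, 1 / 2, rfl, ?_⟩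
    rw [← hi]
    push_cast
    ring
  have hIinter : ∀ i j, I.card ≤ (A i ∩ A j).card := fun i j =>
    Finset.card_le_card (Finset.subset_inter (hIle i) (hIle j))
  have hne : A ⟨0, by omega⟩ ≠ A ⟨1, by omega⟩ := fun hh => by
    simpa using hinj hh
  by_cases htwo : ∃ i, (A i).card = 2
  · obtain ⟨i, hi⟩ := htwo
    by_cases hfour : ∃ j, (A j).card = 4
    · obtain ⟨j, hj⟩ := hfour
      have hle := Finset.card_le_card (hIle i)
      by_cases h1 : I.card = 1
      · exact ⟨i, by omega⟩
      · exact ⟨j, by omega⟩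
    · push Not at hfour
      have hall := fun j => (card_of_mem_maxFamily (hA j)).resolve_right (hfour j)
      have h1 := inter_of_mem_maxFamily_two hn (hA _) (hA _) hne (hall _) (hall _)
      have h2 := hIinter ⟨0, by omega⟩ ⟨1, by omega⟩
      exact ⟨i, by omega⟩
  · push Not at htwo
    have hall := fun j => (card_of_mem_maxFamily (hA j)).resolve_left (htwo j)
    have h1 := inter_of_mem_maxFamily_four hn (hA _) (hA _) hne (hall _) (hall _)
    have hIeq : I = {⟨0, by omega⟩, ⟨1, by omega⟩} := by
      apply Finset.Subset.antisymm
      · exact (Finset.subset_inter (hIle _) (hIle _)).trans h1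
      · refine Finset.le_inf fun i _ => ?_
        rw [Finset.insert_subset_iff, Finset.singleton_subset_iff]
        exact ⟨zero_mem_of_mem_maxFamily hn (hA i), one_mem_of_mem_maxFamily hn (hA i) (hall i)⟩
    refine ⟨⟨0, by omega⟩, ?_⟩
    rw [hall, hIeq, Finset.card_pair (by simp [Fin.ext_iff])]

theorem card_maxFamily {n : ℕ} (hn : 2 ≤ n) : (maxFamily n).card = 3 * n / 2 - 2 := by
  let f : Fin (n - 1) → Finset (Fin n) := fun i => {⟨0, by omega⟩, ⟨i + 1, by omega⟩}
  let g : Fin (n / 2 - 1) → Finset (Fin n) := fun i =>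
    {⟨0, by omega⟩, ⟨1, by omega⟩, ⟨2 * (i + 1), by omega⟩, ⟨2 * (i + 1) + 1, by omega⟩}
  have hf : Function.Injective f := by
    intro i j hij
    have h1 : (⟨i + 1, by omega⟩ : Fin n) ∈ f j := by rw [← hij]; simp [f]
    simp only [f, Finset.mem_insert, Finset.mem_singleton, Fin.ext_iff] at h1
    exact Fin.ext (by omega)
  have hg : Function.Injective g := by
    intro i j hij
    have h1 : (⟨2 * (i + 1), by omega⟩ : Fin n) ∈ g j := by rw [← hij]; simp [g]
    simp only [g, Finset.mem_insert, Finset.mem_singleton, Fin.ext_iff] at h1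
    exact Fin.ext (by omega)
  have heq : maxFamily n = Finset.univ.image f ∪ Finset.univ.image g := by
    ext A
    rw [mem_maxFamily, Finset.mem_union, Finset.mem_image, Finset.mem_image]
    refine or_congr ⟨?_, ?_⟩ ⟨?_, ?_⟩
    · rintro ⟨a, b, ha, hb, rfl⟩
      refine ⟨⟨b - 1, by omega⟩, Finset.mem_univ _, ?_⟩
      ext z
      simp only [f, Finset.mem_insert, Finset.mem_singleton, Fin.ext_iff]
      omega
    · rintro ⟨i, -, rfl⟩
      exact ⟨_, _, rfl, by simp, rfl⟩
    · rintro ⟨k, a, b, c, d, hk, ha, hb, hc, hd, rfl⟩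
      refine ⟨⟨k - 1, by omega⟩, Finset.mem_univ _, ?_⟩
      ext z
      simp only [g, Finset.mem_insert, Finset.mem_singleton, Fin.ext_iff]
      omega
    · rintro ⟨i, -, rfl⟩
      exact ⟨i + 1, _, _, _, _, by omega, rfl, rfl, rfl, rfl, rfl⟩
  have hdisj : Disjoint (Finset.univ.image f) (Finset.univ.image g) := by
    rw [Finset.disjoint_left]
    intro A hA hA'
    obtain ⟨i, -, rfl⟩ := Finset.mem_image.1 hA
    obtain ⟨j, -, hj⟩ := Finset.mem_image.1 hA'
    have h1 : (⟨2 * (j + 1), by omega⟩ : Fin n) ∈ f i := by rw [← hj]; simp [g]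
    have h2 : (⟨1, by omega⟩ : Fin n) ∈ f i := by rw [← hj]; simp [g]
    simp only [f, Finset.mem_insert, Finset.mem_singleton, Fin.ext_iff] at h1 h2
    omega
  rw [heq, Finset.card_union_of_disjoint hdisj, Finset.card_image_of_injective _ hf,
    Finset.card_image_of_injective _ hg, Finset.card_univ, Finset.card_univ, Fintype.card_fin,
    Fintype.card_fin]
  omega

/-! ### Bound, uniqueness and robustness. -/

theorem IsBisectionClosed.card_le {n r : ℕ} (hn : 2 ≤ n) (hr : 3 ≤ r)
    {F : Finset (Finset (Fin n))} (h : IsBisectionClosed r F) (hne : ∀ A ∈ F, A.Nonempty)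
    (hone : n ≤ 3 → ∀ A ∈ F, A.card ≠ 1) : F.card ≤ 3 * n / 2 - 2 := by
  by_cases h1 : ∀ A ∈ F, A.card ≠ 1
  · have := (h.card_structure hn hr hne h1).1
    omega
  · have hn3 : ¬ n ≤ 3 := fun hh => h1 (hone hh)
    push Not at h1
    obtain ⟨A, hA, hc⟩ := h1
    -- n ≤ ⌊3n/2⌋ - 2 holds from n = 4 on.
    have := h.card_le_of_singleton hr hne hA hc
    omega

theorem eq_singleton_univ {F : Finset (Finset (Fin 2))} (hne : ∀ A ∈ F, A.Nonempty)
    (hone : ∀ A ∈ F, A.card ≠ 1) (hF : F.card = 1) : F = {Finset.univ} := by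
  obtain ⟨A, rfl⟩ := Finset.card_eq_one.1 hF
  have h1 := (hne A (Finset.mem_singleton_self A)).card_pos
  have h2 := hone A (Finset.mem_singleton_self A)
  rw [Finset.eq_univ_of_card A (by
    have := Finset.card_le_univ A
    rw [Fintype.card_fin] at this ⊢
    omega)]

theorem IsBisectionClosed.exists_eq_permFamily {n r : ℕ} (hn : 2 ≤ n) (hr : 3 ≤ r)
    {F : Finset (Finset (Fin n))} (h : IsBisectionClosed r F) (hne : ∀ A ∈ F, A.Nonempty)
    (hone : n ≤ 5 → ∀ A ∈ F, A.card ≠ 1) (hF : F.card = 3 * n / 2 - 2) :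
    ∃ σ : Equiv.Perm (Fin n), maxFamily n = permFamily σ F := by
  have h1 : ∀ A ∈ F, A.card ≠ 1 := by
    intro A hA hc
    have h2 := h.card_le_of_singleton hr hne hA hc
    -- A singleton gives |F| ≤ n, and ⌊3n/2⌋ - 2 exceeds n once n ≥ 6.
    exact hone (by omega) A hA hc
  rcases (h.card_structure hn hr hne h1).2.1 (by omega) with rfl | ⟨h2, h24⟩
  · refine ⟨1, ?_⟩
    have h3 : permFamily 1 F = F := by simp [permFamily]
    rw [h3, eq_singleton_univ hne h1 hF, eq_singleton_univ (F := maxFamily 2) _ _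
      (card_maxFamily le_rfl)]
    · intro A hA
      exact ⟨_, zero_mem_of_mem_maxFamily le_rfl hA⟩
    · intro A hA
      have := card_of_mem_maxFamily hA
      omega
  · obtain ⟨x, hx⟩ := h.exists_common hr hne h2
    obtain ⟨σ, hσ⟩ := h.exists_perm hn hr hx
    refine ⟨σ, (Finset.eq_of_subset_of_card_le ?_ ?_).symm⟩
    · intro B hB
      obtain ⟨A, hA, rfl⟩ := Finset.mem_image.1 hB
      exact hσ A hA (h24 A hA)
    · rw [card_permFamily, card_maxFamily hn, hF]

theorem IsBisectionClosed.exists_card_sdiff_lt {n r : ℕ} (hn : 2 ≤ n) (hr : 3 ≤ r)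
    {F : Finset (Finset (Fin n))} (h : IsBisectionClosed r F) (hne : ∀ A ∈ F, A.Nonempty)
    {ε : ℝ} (hε : 0 < ε) (hε' : ε < 1 / 10) (hF : (3 / 2 - ε) * (n : ℝ) ≤ (F.card : ℝ)) :
    ∃ σ : Equiv.Perm (Fin n),
      ((permFamily σ F \ maxFamily n).card : ℝ) < 3 * ε * (n : ℝ) := by
  have hn0 : (0 : ℝ) < n := by exact_mod_cast (by omega : 0 < n)
  have hlow : (14 * n : ℝ) < 10 * F.card := by nlinarith
  have hlow' : 14 * n < 10 * F.card := by exact_mod_cast hlow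
  have h1 : ∀ A ∈ F, A.card ≠ 1 := by
    intro A hA hc
    have := h.card_le_of_singleton hr hne hA hc
    omega
  obtain ⟨h2, hbad⟩ := (h.card_structure hn hr hne h1).2.2 hlow'.le
  obtain ⟨x, hx⟩ := h.exists_common hr hne h2
  obtain ⟨σ, hσ⟩ := h.exists_perm hn hr hx
  refine ⟨σ, ?_⟩
  have hsub : permFamily σ F \ maxFamily n
      ⊆ permFamily σ (F.filter fun A => ¬ (A.card = 2 ∨ A.card = 4)) := by
    intro B hB
    rw [Finset.mem_sdiff] at hB
    obtain ⟨A, hA, rfl⟩ := Finset.mem_image.1 hB.1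
    exact Finset.mem_image_of_mem _
      (Finset.mem_filter.2 ⟨hA, fun hc => hB.2 (hσ A hA hc)⟩)
  have hle := Finset.card_le_card hsub
  rw [card_permFamily] at hle
  -- The exceptional sets number at most 3n - 2|F| ≤ 2εn; the constant 3 makes the inequality
  -- strict.
  have hsum : ((permFamily σ F \ maxFamily n).card : ℝ) + 2 * F.card ≤ 3 * n := by
    exact_mod_cast (by omega : (permFamily σ F \ maxFamily n).card + 2 * F.card ≤ 3 * n)
  have hpos := mul_pos hε hn0
  linarith

theorem theorem2 :
    -- the bound
    (∀ n r : ℕ, 2 ≤ n → 3 ≤ r → ∀ F : Finset (Finset (Fin n)),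
      IsBisectionClosed r F → (∀ A ∈ F, A.Nonempty) →
      (n ≤ 3 → ∀ A ∈ F, A.card ≠ 1) →
        F.card ≤ 3 * n / 2 - 2) ∧
    -- tightness
    (∀ n r : ℕ, 2 ≤ n → 3 ≤ r →
      IsBisectionClosed r (maxFamily n) ∧ (∀ A ∈ maxFamily n, 2 ≤ A.card) ∧
        (maxFamily n).card = 3 * n / 2 - 2) ∧
    -- uniqueness
    (∀ n r : ℕ, 2 ≤ n → 3 ≤ r → ∀ F : Finset (Finset (Fin n)),
      IsBisectionClosed r F → (∀ A ∈ F, A.Nonempty) →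
      (n ≤ 5 → ∀ A ∈ F, A.card ≠ 1) →
      F.card = 3 * n / 2 - 2 →
        ∃ σ : Equiv.Perm (Fin n), maxFamily n = permFamily σ F) ∧
    -- robustness, with an absolute constant
    (∃ C : ℝ, 0 < C ∧ ∀ n r : ℕ, 2 ≤ n → 3 ≤ r → ∀ F : Finset (Finset (Fin n)),
      IsBisectionClosed r F → (∀ A ∈ F, A.Nonempty) →
      ∀ ε : ℝ, 0 < ε → ε < 1 / 10 → (3 / 2 - ε) * (n : ℝ) ≤ (F.card : ℝ) →
        ∃ σ : Equiv.Perm (Fin n),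
          ((permFamily σ F \ maxFamily n).card : ℝ) < C * ε * (n : ℝ)) := by
  refine ⟨fun n r hn hr F h hne hone => h.card_le hn hr hne hone, fun n r hn _ => ?_,
    fun n r hn hr F h hne hone hF => h.exists_eq_permFamily hn hr hne hone hF, 3, by norm_num,
    fun n r hn hr F h hne ε hε hε' hF => h.exists_card_sdiff_lt hn hr hne hε hε' hF⟩
  refine ⟨isBisectionClosed_maxFamily hn r, fun A hA => ?_, card_maxFamily hn⟩
  have := card_of_mem_maxFamily hA
  omega
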